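/- Let $\mathbb F=x_1x_2x_3\cdots$ be the infinite Fibonacci word, that is, the fixed point beginning with $a$ of the morphism $\sigma(a)=ab$, $\sigma(b)=a$. For $n\ge 1$ let $a(n)$ be the number of occurrences of non-empty palindromes in $\mathbb F$ whose last letter is at position $n$; that is, the number of pairs $(\omega,p)$ where $\omega$ is a non-empty palindrome occurring in $\mathbb F$ and the $p$-th occurrence of $\omega$ in $\mathbb F$ ends at position $n$. Let $f_m$ be the Fibonacci numbers with $f_0=1$, $f_1=2$, $f_m=f_{m-1}+f_{m-2}$ for $m\ge 2$. Then $$[a(1)]=[1],\qquad [a(2),a(3)]=[1,2],$$ and for every $m\ge 3$ $$[a(f_m-1),\ldots,a(f_{m+1}-2)]=[a(f_{m-2}-1),\ldots,a(f_{m-1}-2),\,a(f_{m-1}-1),\ldots,a(f_m-2)]+[\underbrace{1,\ldots,1}_{f_{m-1}}].$$ -/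

import Mathlib

namespace FibPal

/-- The two-letter alphabet `{a, b}`. -/
inductive Letter where
  | a : Letter
  | b : Letter
  deriving DecidableEq

/-- The images of the letters under the Fibonacci morphism: `a ↦ ab`, `b ↦ a`. -/
def sigmaLetter : Letter → List Letter
  | Letter.a => [Letter.a, Letter.b]
  | Letter.b => [Letter.a]

/-- The Fibonacci morphism `σ` on finite words. -/
def sigma (w : List Letter) : List Letter := w.flatMap sigmaLetter

/-- The finite Fibonacci words `F_m = σ^m(a)`, `m ≥ 0`. -/
def finiteWord (m : ℕ) : List Letter := sigma^[m] [Letter.a]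

theorem sigma_append (u v : List Letter) : sigma (u ++ v) = sigma u ++ sigma v := by
  simp [sigma]

theorem finiteWord_succ (m : ℕ) : finiteWord (m + 1) = sigma (finiteWord m) := by
  simp [finiteWord, Function.iterate_succ_apply']

theorem finiteWord_succ_succ (m : ℕ) :
    finiteWord (m + 2) = finiteWord (m + 1) ++ finiteWord m := by
  induction m with
  | zero => rfl
  | succ k ih =>
    rw [finiteWord_succ (k + 2), ih, sigma_append, ← finiteWord_succ, ← finiteWord_succ, ih]

/-- The Fibonacci numbers `f_m` for `m ≥ 0`, normalised by `f_0 = 1`, `f_1 = 2`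
(so that `f_{-2} = 0` and `f_{-1} = 1` precede them). -/
def f (m : ℕ) : ℕ := Nat.fib (m + 2)

theorem length_finiteWord (m : ℕ) : (finiteWord m).length = f m := by
  induction m using Nat.twoStepInduction with
  | zero => rfl
  | one => rfl
  | more k h0 h1 =>
    rw [finiteWord_succ_succ, List.length_append, h0, h1]
    simp only [f]
    rw [Nat.fib_add_two (n := k + 2)]
    ring_nf

theorem lt_length_finiteWord (m : ℕ) : m < (finiteWord m).length := by
  rw [length_finiteWord]
  induction m with
  | zero => decide
  | succ k ih =>
    have h : Nat.fib (k + 3) = Nat.fib (k + 1) + Nat.fib (k + 2) := Nat.fib_add_two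
    have h' : 0 < Nat.fib (k + 1) := Nat.fib_pos.2 (by omega)
    simp only [f] at *
    rw [show k + 1 + 2 = k + 3 from rfl]
    omega

/-- The infinite Fibonacci word: `fibWord n` is its letter at position `n`, where positions
are numbered `1, 2, 3, …` (the value at `0` is irrelevant). It is read off the prefix
`F_n`, which has more than `n` letters. -/
def fibWord (n : ℕ) : Letter :=
  (finiteWord n)[n - 1]'(lt_of_le_of_lt (Nat.sub_le n 1) (lt_length_finiteWord n))

/-- The factor of the infinite Fibonacci word from position `i` to position `j`
(the empty word if `j < i`). -/
def factor (i j : ℕ) : List Letter := (List.range' i (j + 1 - i)).map fibWord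

theorem finiteWord_prefix_succ (m : ℕ) : finiteWord m <+: finiteWord (m + 1) := by
  cases m with
  | zero => exact ⟨[Letter.b], rfl⟩
  | succ k => exact ⟨finiteWord k, (finiteWord_succ_succ k).symm⟩

theorem finiteWord_prefix {m n : ℕ} (h : m ≤ n) : finiteWord m <+: finiteWord n := by
  induction n, h using Nat.le_induction with
  | base => exact List.prefix_rfl
  | succ n _ ih => exact ih.trans (finiteWord_prefix_succ n)

/-- Every `F_m` is a prefix of the infinite word. -/
theorem finiteWord_getElem (m i : ℕ) (h : i < (finiteWord m).length) :
    (finiteWord m)[i] = fibWord (i + 1) := by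
  have h' : i < (finiteWord (i + 1)).length := by
    have := lt_length_finiteWord (i + 1)
    omega
  change _ = (finiteWord (i + 1))[i]
  rcases le_total m (i + 1) with hm | hm
  · exact (finiteWord_prefix hm).getElem h
  · exact ((finiteWord_prefix hm).getElem h').symm

theorem prefix_finiteWord_eq {w : List Letter} {m : ℕ} (h : w <+: finiteWord m) :
    w = factor 1 w.length := by
  apply List.ext_getElem
  · simp [factor]
  · intro i h1 h2
    rw [h.getElem h1, finiteWord_getElem]
    simp [factor, add_comm]

/-- The infinite Fibonacci word begins with `a`. -/
theorem fibWord_one : fibWord 1 = Letter.a := rfl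

/-- The infinite Fibonacci word is a fixed point of `σ`: the image of each of its prefixes is
again one of its prefixes. -/
theorem sigma_factor (n : ℕ) :
    sigma (factor 1 n) = factor 1 (sigma (factor 1 n)).length := by
  have hp : factor 1 n = (finiteWord n).take n := by
    have h := prefix_finiteWord_eq (List.take_prefix n (finiteWord n))
    rw [List.length_take, min_eq_left (lt_length_finiteWord n).le] at h
    exact h.symm
  refine prefix_finiteWord_eq (m := n + 1) ?_
  rw [hp, finiteWord_succ]
  refine ⟨sigma ((finiteWord n).drop n), ?_⟩
  rw [← sigma_append, List.take_append_drop]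

/-- The word `ω` occurs in the infinite Fibonacci word with its first letter at position `l`. -/
def OccursAt (ω : List Letter) (l : ℕ) : Prop :=
  1 ≤ l ∧ factor l (l + ω.length - 1) = ω

/-- `ω_p` begins at position `l`: `ω` occurs at `l`, and this is its `p`-th occurrence
from the left. -/
def IsOccurrence (ω : List Letter) (p l : ℕ) : Prop :=
  OccursAt ω l ∧ {k : ℕ | k ≤ l ∧ OccursAt ω k}.ncard = p

/-- The non-empty palindromes occurring in the infinite Fibonacci word. -/
def palindromes : Set (List Letter) :=
  {ω | ω ≠ [] ∧ ω.Palindrome ∧ ∃ l, OccursAt ω l}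

/-- The occurrences `ω_p` of palindromes, as pairs `(ω, p)`, whose last letter is at
position `n`. -/
def endingAt (n : ℕ) : Set (List Letter × ℕ) :=
  {x | x.1 ∈ palindromes ∧ ∃ l, IsOccurrence x.1 x.2 l ∧ l + x.1.length - 1 = n}

theorem endingAt_finite (n : ℕ) : (endingAt n).Finite := by
  refine ((Set.finite_Icc 1 n).image (fun l => (factor l n,
    {k : ℕ | k ≤ l ∧ OccursAt (factor l n) k}.ncard))).subset ?_
  rintro ⟨ω, p⟩ ⟨⟨hne, -, -⟩, l, ⟨⟨hl, hω⟩, hp⟩, hn⟩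
  have hlen : 0 < ω.length := List.length_pos_iff.2 hne
  dsimp only at *
  refine ⟨l, ⟨hl, by omega⟩, ?_⟩
  rw [hn] at hω
  simp only [hω, hp]

/-- `a n` is the number of occurrences of (non-empty) palindromes in the infinite Fibonacci
word that end at position `n`. -/
noncomputable def a (n : ℕ) : ℕ := (endingAt n).ncard

/-- The vector `[a(i), a(i+1), …, a(j)]`. -/
noncomputable def block (i j : ℕ) : List ℕ := (List.range' i (j + 1 - i)).map a

end FibPal

namespace FibPal

/-! Write p = f_k and q = f_{k+1}. Palindromes ending at n + q, where p - 1 ≤ n ≤ f_{k+2} - 2, are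
sorted by their starting position. Those starting after q are the translates by q of the palindromes
ending at n, because the prefix of length f_{k+3} - 2 has period q (`fibWord_add_f`). Exactly one
starts at or before q. It exists because that prefix is itself a palindrome (`fibWord_reflect`). It
is unique because the period p fails in that prefix only at q - 1 and q (`fibWord_add_f_ne_iff`),
and reflection in a palindrome must respect these two failures. Hence a(n + q) = a(n) + 1. -/

theorem f_add_two (k : ℕ) : f (k + 2) = f (k + 1) + f k := by
  simp only [f]
  rw [Nat.fib_add_two (n := k + 2), add_comm]

theorem f_pos (k : ℕ) : 1 ≤ f k := Nat.fib_pos.2 (by omega)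

theorem two_le_f_succ (k : ℕ) : 2 ≤ f (k + 1) := by
  induction k with
  | zero => decide
  | succ k ih =>
    have h : f (k + 1 + 1) = f (k + 1) + f k := f_add_two k
    have := f_pos k
    omega

theorem f_lt_f_succ (k : ℕ) : f k < f (k + 1) := by
  cases k with
  | zero => decide
  | succ k =>
    have h : f (k + 1 + 1) = f (k + 1) + f k := f_add_two k
    have := f_pos k
    omega

/-! ### Periods, palindromic prefixes and period failures -/

/-- `F_{k+2} = F_{k+1} F_k`, letter by letter. -/
theorem fibWord_add_f_succ (k j : ℕ) (h1 : 1 ≤ j) (h2 : j ≤ f k) :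
    fibWord (j + f (k + 1)) = fibWord j := by
  obtain ⟨i, rfl⟩ := Nat.exists_eq_add_of_le' h1
  have hk : i < (finiteWord k).length := by rw [length_finiteWord]; omega
  have hs : i + f (k + 1) < (finiteWord (k + 2)).length := by
    rw [length_finiteWord, f_add_two]; omega
  have e1 := finiteWord_getElem (k + 2) (i + f (k + 1)) hs
  have e2 := finiteWord_getElem k i hk
  rw [show i + 1 + f (k + 1) = i + f (k + 1) + 1 by ring, ← e1, ← e2]
  simp only [finiteWord_succ_succ k]
  rw [List.getElem_append_right (by rw [length_finiteWord]; omega)]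
  simp [length_finiteWord]

/-- The prefix of length `f_{k+2} - 2` has period `f_k`. -/
theorem fibWord_add_f (k : ℕ) :
    ∀ j, 1 ≤ j → j + 2 ≤ f (k + 1) → fibWord (j + f k) = fibWord j := by
  induction k with
  | zero =>
    intro j h1 h2
    have : f (0 + 1) = 2 := rfl
    omega
  | succ k ih =>
    intro j h1 h2
    rw [f_add_two] at h2
    rcases le_or_gt j (f k) with hj | hj
    · exact fibWord_add_f_succ k j h1 hj
    -- Beyond f_k, the two shifts add up to f_{k+2}, which is removed at once; the period f_k then
    -- restores the position.
    · obtain ⟨i, rfl⟩ := Nat.exists_eq_add_of_lt hj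
      have e1 := ih (i + 1) (by omega) (by omega)
      have e2 := fibWord_add_f_succ (k + 1) (i + 1) (by omega) (by omega)
      rw [f_add_two] at e2
      rw [show f k + i + 1 + f (k + 1) = i + 1 + (f (k + 1) + f k) by ring, e2, ← e1]
      congr 1
      ring

/-- The prefix of length `f_k - 2` is a palindrome. -/
theorem fibWord_reflect (k : ℕ) :
    ∀ i j, 1 ≤ i → 1 ≤ j → i + j + 1 = f k → fibWord i = fibWord j := by
  induction k using Nat.twoStepInduction with
  | zero => intro i j hi hj h; have : f 0 = 1 := rfl; omega
  | one => intro i j hi hj h; have : f 1 = 2 := rfl; omega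
  | more k _ ih =>
    intro i j hi hj h
    rw [f_add_two] at h
    have aux : ∀ i j, 1 ≤ i → 1 ≤ j → i + j + 1 = f (k + 1) + f k → f k < j →
        fibWord i = fibWord j := by
      intro i j hi hj h hlt
      obtain ⟨t, rfl⟩ := Nat.exists_eq_add_of_lt hlt
      rw [show f k + t + 1 = t + 1 + f k by ring,
        fibWord_add_f k (t + 1) (by omega) (by omega)]
      exact ih i (t + 1) hi (by omega) (by omega)
    rcases lt_or_ge (f k) j with hlt | hge
    · exact aux i j hi hj h hlt
    rcases lt_or_ge (f k) i with hlt' | hge'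
    · exact (aux j i hj hi (by omega) hlt').symm
    -- With i, j ≤ f_k, the sum condition leaves only the centre i = j.
    · have := f_lt_f_succ k
      rw [show i = j by omega]

/-- The last letters of consecutive words `F_k` differ. -/
theorem fibWord_f_ne (k : ℕ) : fibWord (f (k + 1)) ≠ fibWord (f k) := by
  induction k with
  | zero => decide
  | succ k ih =>
    have e := fibWord_add_f_succ k (f k) (f_pos k) le_rfl
    rw [f_add_two, add_comm, e]
    exact ih.symm

/-- The penultimate letters of consecutive words `F_k` differ. -/
theorem fibWord_f_sub_one_ne (k : ℕ) :
    fibWord (f (k + 2) - 1) ≠ fibWord (f (k + 1) - 1) := by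
  induction k with
  | zero => decide
  | succ k ih =>
    have h2 := two_le_f_succ k
    have e := fibWord_add_f_succ (k + 1) (f (k + 1) - 1) (by omega) (by omega)
    rw [f_add_two (k + 1),
      show f (k + 1 + 1) + f (k + 1) - 1 = f (k + 1) - 1 + f (k + 1 + 1) by omega, e]
    exact ih.symm

/-- In the prefix of length `f_{k+3} - 2`, the only two places where the period `f_k` fails. -/
theorem fibWord_add_f_ne_iff (k i : ℕ) (hk : 1 ≤ k) (h1 : 1 ≤ i) (h2 : i + 2 ≤ 2 * f (k + 1)) :
    fibWord i ≠ fibWord (i + f k) ↔ i + 1 = f (k + 1) ∨ i = f (k + 1) := by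
  obtain ⟨k, rfl⟩ := Nat.exists_eq_add_of_le' hk
  have hr := two_le_f_succ k
  have hq := two_le_f_succ (k + 1)
  have hp : f (k + 1 + 1 + 1) = f (k + 1 + 1) + f (k + 1) := f_add_two (k + 1)
  have hq' : f (k + 2) = f (k + 1 + 1) := rfl
  -- In the indexing of the statement: at i = f_{k+1} - 1 and i = f_{k+1}, the period f_{k+1}
  -- carries i + f_k back to f_k - 1 and f_k, so penultimate or last letters of consecutive F's are
  -- compared. Beyond, both positions drop by f_{k+1}, into the range where the period f_k holds.
  rcases lt_trichotomy (i + 1) (f (k + 1 + 1)) with h | h | h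
  · have := fibWord_add_f (k + 1) i h1 (by omega)
    simp only [this, ne_eq, not_true_eq_false, false_iff]
    omega
  · refine iff_of_true ?_ (Or.inl h)
    have e := fibWord_add_f (k + 1 + 1) (f (k + 1) - 1) (by omega) (by omega)
    rw [show i + f (k + 1) = f (k + 1) - 1 + f (k + 1 + 1) by omega, e,
      show i = f (k + 2) - 1 by omega]
    exact fibWord_f_sub_one_ne k
  · rcases Nat.eq_or_lt_of_le (Nat.lt_succ_iff.1 h) with h | h
    · refine iff_of_true ?_ (Or.inr h.symm)
      have e := fibWord_add_f (k + 1 + 1) (f (k + 1)) (by omega) (by omega)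
      rw [← h, add_comm (f (k + 1 + 1)), e]
      exact fibWord_f_ne (k + 1)
    · obtain ⟨t, rfl⟩ := Nat.exists_eq_add_of_lt h
      have e1 := fibWord_add_f (k + 1 + 1) (t + 1) (by omega) (by omega)
      have e2 := fibWord_add_f (k + 1 + 1) (t + 1 + f (k + 1)) (by omega) (by omega)
      have e3 := fibWord_add_f (k + 1) (t + 1) (by omega) (by omega)
      rw [show f (k + 1 + 1) + t + 1 = t + 1 + f (k + 1 + 1) by ring, e1,
        show t + 1 + f (k + 1 + 1) + f (k + 1) = t + 1 + f (k + 1) + f (k + 1 + 1) by ring,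
        e2, e3]
      simp only [ne_eq, not_true_eq_false, false_iff]
      omega

/-! ### Counting palindromes by starting position -/

/-- The starting positions of the palindromes that end at position `n`. -/
def palStarts (n : ℕ) : Finset ℕ :=
  (Finset.Icc 1 n).filter fun l => ∀ i ∈ Finset.Icc l n, fibWord i = fibWord (l + n - i)

theorem mem_palStarts {l n : ℕ} :
    l ∈ palStarts n ↔
      1 ≤ l ∧ l ≤ n ∧ ∀ i j, l ≤ i → l ≤ j → i + j = l + n → fibWord i = fibWord j := by
  simp only [palStarts, Finset.mem_filter, Finset.mem_Icc, and_assoc]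
  refine and_congr_right fun _ => and_congr_right fun _ => ⟨fun h i j hi hj e => ?_,
    fun h i hi => h i _ hi.1 (by omega) (by omega)⟩
  rw [h i ⟨hi, by omega⟩]
  congr 1
  omega

theorem length_factor (l n : ℕ) : (factor l n).length = n + 1 - l := by simp [factor]

theorem palindrome_factor_iff {l n : ℕ} (h1 : 1 ≤ l) (h2 : l ≤ n) :
    (factor l n).Palindrome ↔ l ∈ palStarts n := by
  rw [List.Palindrome.iff_reverse_eq, mem_palStarts]
  constructor
  · intro h
    refine ⟨h1, h2, fun i j hi hj e => ?_⟩
    have hlt : i - l < (factor l n).reverse.length := by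
      rw [List.length_reverse, length_factor]; omega
    have := List.getElem_of_eq h hlt
    simp only [factor, List.getElem_reverse, List.getElem_map, List.getElem_range',
      List.length_map, List.length_range', one_mul] at this
    rw [show l + (n + 1 - l - 1 - (i - l)) = j by omega, show l + (i - l) = i by omega] at this
    exact this.symm
  · rintro ⟨-, -, h⟩
    apply List.ext_getElem
    · simp
    · intro i hi hi'
      rw [length_factor] at hi'
      simp only [factor, List.getElem_reverse, List.getElem_map, List.getElem_range',
        List.length_map, List.length_range', one_mul]
      exact h _ _ (by omega) (by omega) (by omega)

/-- With the end fixed, the length of an occurrence determines its start, so words with their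
occurrence numbers can be replaced by starting positions. -/
theorem a_eq_card_palStarts (n : ℕ) : a n = (palStarts n).card := by
  have key : endingAt n = (fun l => (factor l n,
      {k : ℕ | k ≤ l ∧ OccursAt (factor l n) k}.ncard)) '' (palStarts n : Set ℕ) := by
    ext ⟨w, p⟩
    constructor
    · rintro ⟨⟨hne, hpal, -⟩, l, ⟨⟨hl, hw⟩, hp⟩, hn⟩
      have hlen : 0 < w.length := List.length_pos_iff.2 hne
      dsimp only at *
      rw [hn] at hw
      refine ⟨l, ?_, by simp only [hw, hp]⟩
      rw [Finset.mem_coe, ← palindrome_factor_iff hl (by omega), hw]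
      exact hpal
    · rintro ⟨l, hl, he⟩
      rw [Finset.mem_coe] at hl
      obtain ⟨h1, h2, -⟩ := mem_palStarts.1 hl
      simp only [Prod.mk.injEq] at he
      obtain ⟨rfl, rfl⟩ := he
      have hend : l + (factor l n).length - 1 = n := by rw [length_factor]; omega
      have hocc : OccursAt (factor l n) l := ⟨h1, by rw [hend]⟩
      refine ⟨⟨?_, (palindrome_factor_iff h1 h2).2 hl, l, hocc⟩, l, ⟨hocc, rfl⟩, hend⟩
      rw [← List.length_pos_iff, length_factor]
      omega
  rw [a, key, Set.InjOn.ncard_image, Set.ncard_coe_finset]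
  intro l hl l' hl' he
  have := congrArg List.length (Prod.ext_iff.1 he).1
  simp only [length_factor] at this
  have h1 := mem_palStarts.1 hl
  have h2 := mem_palStarts.1 hl'
  omega

/-! ### The recursion for a -/

/-- The palindromes that end at position `n` and start at or before position `f_{k+1}`: there is
only the one whose centre is that of the prefix of length `f_{k+3} - 2`. -/
theorem mem_palStarts_iff_add_eq {k n l : ℕ} (hk : 1 ≤ k) (h1 : f (k + 2) ≤ n + 1)
    (h2 : n + 2 ≤ f (k + 3)) (hl : l ≤ f (k + 1)) :
    l ∈ palStarts n ↔ l + n + 1 = f (k + 3) := by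
  have hp := f_add_two k
  have hN := f_add_two (k + 1)
  have hr := f_pos k
  simp only [show k + 1 + 1 = k + 2 from rfl, show k + 1 + 2 = k + 3 from rfl] at hN
  constructor
  · intro h
    obtain ⟨hl1, hln, hpal⟩ := mem_palStarts.1 h
    -- Reflection swaps i with l + n - i, so it sends the pair (i, i + f_k) to another pair at
    -- distance f_k, and unequal pairs to unequal pairs.
    have refl : ∀ i, l ≤ i → i + f k ≤ n → (i + 1 = f (k + 1) ∨ i = f (k + 1)) →
        l + n - f k - i + 1 = f (k + 1) ∨ l + n - f k - i = f (k + 1) := by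
      intro i hi hin hi'
      rw [← fibWord_add_f_ne_iff k i hk (by omega) (by omega)] at hi'
      rw [← fibWord_add_f_ne_iff k _ hk (by omega) (by omega)]
      rw [hpal (l + n - f k - i) (i + f k) (by omega) (by omega) (by omega),
        hpal (l + n - f k - i + f k) i (by omega) hi (by omega)]
      exact hi'.symm
    -- An unequal pair cannot be its own mirror image.
    have nofix : ∀ i, l ≤ i → i + f k ≤ n → (i + 1 = f (k + 1) ∨ i = f (k + 1)) →
        i + (i + f k) ≠ l + n := by
      intro i hi hin hi' e
      rw [← fibWord_add_f_ne_iff k i hk (by omega) (by omega)] at hi'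
      exact hi' (hpal _ _ hi (by omega) e)
    -- If the failure at f_{k+1} - 1 lies inside, its image must be the other one, which fixes l +
    -- n. Otherwise l = f_{k+1}: a failure at f_{k+1} would have no admissible image, so n = f_{k+2}
    -- - 1.
    by_cases hA : l + 1 ≤ f (k + 1)
    · have a1 := refl (f (k + 1) - 1) (by omega) (by omega) (by omega)
      have a2 := nofix (f (k + 1) - 1) (by omega) (by omega) (by omega)
      omega
    · by_cases hB : f (k + 1) + f k ≤ n
      · have b1 := refl (f (k + 1)) (by omega) (by omega) (by omega)
        have b2 := nofix (f (k + 1)) (by omega) (by omega) (by omega)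
        omega
      · omega
  · intro h
    rw [mem_palStarts]
    exact ⟨by omega, by omega, fun i j hi hj e =>
      fibWord_reflect (k + 3) i j (by omega) (by omega) (by omega)⟩

/-- Palindromes starting after position `f_{k+1}` are translates by that period. -/
theorem add_mem_palStarts_iff {k n l : ℕ} (h2 : n + f (k + 1) + 2 ≤ f (k + 3)) (hl : 1 ≤ l) :
    l + f (k + 1) ∈ palStarts (n + f (k + 1)) ↔ l ∈ palStarts n := by
  have hN := f_add_two (k + 1)
  simp only [show k + 1 + 1 = k + 2 from rfl, show k + 1 + 2 = k + 3 from rfl] at hN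
  have per : ∀ i, 1 ≤ i → i ≤ n → fibWord (i + f (k + 1)) = fibWord i :=
    fun i hi hin => fibWord_add_f (k + 1) i hi (by
      rw [show k + 1 + 1 = k + 2 from rfl]; omega)
  rw [mem_palStarts, mem_palStarts]
  constructor
  · rintro ⟨-, hln, h⟩
    refine ⟨hl, by omega, fun i j hi hj e => ?_⟩
    rw [← per i (by omega) (by omega), ← per j (by omega) (by omega)]
    exact h _ _ (by omega) (by omega) (by omega)
  · rintro ⟨-, hln, h⟩
    refine ⟨by omega, by omega, fun i j hi hj e => ?_⟩
    obtain ⟨i, rfl⟩ := Nat.exists_eq_add_of_le' (show f (k + 1) ≤ i by omega)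
    obtain ⟨j, rfl⟩ := Nat.exists_eq_add_of_le' (show f (k + 1) ≤ j by omega)
    rw [per i (by omega) (by omega), per j (by omega) (by omega)]
    exact h _ _ (by omega) (by omega) (by omega)

/-- Combines the translated palindromes with the single one that starts at or before f_{k+1}. -/
theorem a_add_f {k n : ℕ} (hk : 1 ≤ k) (h1 : f k ≤ n + 1) (h2 : n + 2 ≤ f (k + 2)) :
    a (n + f (k + 1)) = a n + 1 := by
  have hp := f_add_two k
  have hN := f_add_two (k + 1)
  simp only [show k + 1 + 1 = k + 2 from rfl, show k + 1 + 2 = k + 3 from rfl] at hN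
  have key : palStarts (n + f (k + 1)) =
      insert (f (k + 3) - 1 - (n + f (k + 1)))
        ((palStarts n).map (addRightEmbedding (f (k + 1)))) := by
    ext l
    simp only [Finset.mem_insert, Finset.mem_map, addRightEmbedding_apply]
    rcases le_or_gt l (f (k + 1)) with hl | hl
    · rw [mem_palStarts_iff_add_eq hk (by omega) (by omega) hl]
      constructor
      · intro h; left; omega
      · rintro (h | ⟨t, ht, rfl⟩)
        · omega
        · have := (mem_palStarts.1 ht).1
          omega
    · obtain ⟨t, rfl⟩ := Nat.exists_eq_add_of_le' hl.le
      rw [add_mem_palStarts_iff (by omega) (by omega)]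
      constructor
      · intro h; exact Or.inr ⟨t, h, rfl⟩
      · rintro (h | ⟨s, hs, e⟩)
        · omega
        · rwa [← Nat.add_right_cancel e]
  rw [a_eq_card_palStarts, a_eq_card_palStarts, key, Finset.card_insert_of_notMem,
    Finset.card_map]
  simp only [Finset.mem_map, addRightEmbedding_apply, not_exists, not_and]
  intro t ht e
  have := (mem_palStarts.1 ht).1
  omega

theorem block_append {i j k : ℕ} (h1 : i ≤ j + 1) (h2 : j ≤ k) :
    block i j ++ block (j + 1) k = block i k := by
  rw [block, block, block, ← List.map_append]
  have := List.range'_append (s := i) (m := j + 1 - i) (n := k + 1 - (j + 1)) (step := 1)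
  rw [one_mul, show i + (j + 1 - i) = j + 1 by omega,
    show j + 1 - i + (k + 1 - (j + 1)) = k + 1 - i by omega] at this
  rw [this]

end FibPal

theorem mainTheorem3 :
    FibPal.block 1 1 = [1] ∧
    FibPal.block 2 3 = [1, 2] ∧
    ∀ m : ℕ, 3 ≤ m →
      FibPal.block (FibPal.f m - 1) (FibPal.f (m + 1) - 2) =
        (FibPal.block (FibPal.f (m - 2) - 1) (FibPal.f (m - 1) - 2) ++
          FibPal.block (FibPal.f (m - 1) - 1) (FibPal.f m - 2)).map (· + 1) := by
  refine ⟨?_, ?_, ?_⟩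
  · simp only [FibPal.block, List.range', List.map, FibPal.a_eq_card_palStarts]
    decide
  · simp only [FibPal.block, List.range', List.map, FibPal.a_eq_card_palStarts]
    decide
  · intro m hm
    obtain ⟨k, rfl⟩ := Nat.exists_eq_add_of_le' (show 2 ≤ m by omega)
    have hp := FibPal.f_add_two k
    have hN := FibPal.f_add_two (k + 1)
    have hr := FibPal.f_pos k
    have hq := FibPal.two_le_f_succ k
    have hrq := FibPal.f_lt_f_succ k
    simp only [show k + 1 + 1 = k + 2 from rfl, show k + 1 + 2 = k + 3 from rfl] at hN
    simp only [show k + 2 + 1 = k + 3 from rfl, show k + 2 - 2 = k from rfl,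
      show k + 2 - 1 = k + 1 from rfl]
    -- The two blocks on the right are adjacent and merge into one, on which `a_add_f` applies
    -- entrywise.
    rw [show FibPal.f (k + 1) - 1 = FibPal.f (k + 1) - 2 + 1 by omega,
      FibPal.block_append (by omega) (by omega)]
    apply List.ext_getElem
    · simp only [FibPal.block, List.length_map, List.length_range']
      omega
    · intro i hi _
      simp only [FibPal.block, List.length_map, List.length_range'] at hi
      simp only [FibPal.block, List.getElem_map, List.getElem_range', one_mul]
      rw [← FibPal.a_add_f (k := k) (by omega) (by omega) (by omega)]
      congr 1
      omega
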